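/- Let $q_0>0$ and let $q:\mathbb R\times\mathbb R\to\mathbb C$, $(x,t)\mapsto q(x,t)$, be differentiable in $x$ with $q(x,t)\to q_\pm$ as $x\to\pm\infty$ for every $t$, where $q_\pm$ are constants with $|q_\pm|=q_0$. Put $$\sigma_3=\begin{pmatrix}1&0\\0&-1\end{pmatrix},\quad \sigma_0=\begin{pmatrix}0&1\\-1&0\end{pmatrix},\quad Q=\begin{pmatrix}0&q\\-q^*&0\end{pmatrix},\quad Q_\pm=\begin{pmatrix}0&q_\pm\\-q_\pm^*&0\end{pmatrix},$$ where $*$ is complex conjugation (entrywise, without transposition, for matrices), and for $z\neq0$ $$k=\tfrac12\Big(z-\frac{q_0^2}{z}\Big),\quad \lambda=\tfrac12\Big(z+\frac{q_0^2}{z}\Big),\quad \theta=\lambda\,(x+kt),\quad Y_\pm(z)=\mathbb I-\frac iz\sigma_3Q_\pm .$$ Let $\Sigma=\{z\in\mathbb C\setminus\{0\}:\ z\in\mathbb R\text{ or }|z|=q_0\}\setminus\{\pm iq_0\}$. Let $\psi_\pm(x,t;z)$, $z\in\Sigma$, be the Jost functions, i.e. the $2\times2$ matrix solutions of the Lax pair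 $$\psi_x=(-ik\sigma_3+Q)\psi,\qquad \psi_t=\Big(-ik^2\sigma_3+kQ-\tfrac i2Q_x\sigma_3-\tfrac i2(Q^2+q_0^2\mathbb I)\sigma_3\Big)\psi$$ with $\psi_\pm e^{i\theta\sigma_3}\to Y_\pm(z)$ as $x\to\pm\infty$ for every $t$. Write $\psi_{\pm,j}$ for the $j$-th column of $\psi_\pm$. (1) For all $z\in\Sigma$ and all $x,t$ (which are suppressed), $$\psi_\pm(z)=-\sigma_0\psi_\pm^*(z^*)\sigma_0,\qquad \psi_\pm(z)=-\frac iz\,\psi_\pm\Big(-\frac{q_0^2}{z}\Big)\sigma_3Q_\pm,$$ and hence, by columns, $$\psi_{\pm,1}(z)=\sigma_0\psi_{\pm,2}^*(z^*),\qquad \psi_{\pm,2}(z)=-\sigma_0\psi_{\pm,1}^*(z^*),$$ $$\psi_{\pm,1}(z)=-\frac{iq_\pm^*}{z}\,\psi_{\pm,2}\Big(-\frac{q_0^2}{z}\Big),\qquad \psi_{\pm,2}(z)=-\frac{iq_\pm}{z}\,\psi_{\pm,1}\Big(-\frac{q_0^2}{z}\Big).$$ (2) For every $z\in\Sigma$ there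 is a unique matrix $S(z)=(s_{ij}(z))$, independent of $x$ and $t$, with $\psi_+(x,t;z)=\psi_-(x,t;z)S(z)$ for all $x,t$, and for all $z\in\Sigma$ $$S^*(z^*)=-\sigma_0S(z)\sigma_0,\qquad S(z)=(\sigma_3Q_-)^{-1}\,S\Big(-\frac{q_0^2}{z}\Big)\,\sigma_3Q_+,$$ $$s_{22}(z)=s_{11}^*(z^*),\quad s_{12}(z)=-s_{21}^*(z^*),\quad s_{11}(z)=\frac{q_+^*}{q_-^*}\,s_{22}\Big(-\frac{q_0^2}{z}\Big),\quad s_{12}(z)=\frac{q_+}{q_-^*}\,s_{21}\Big(-\frac{q_0^2}{z}\Big).$$ (3) Let $\rho=s_{21}/s_{11}$ and $\tilde\rho=s_{12}/s_{22}$. For every $z\in\Sigma$ with $s_{11}(z)\neq0$ one has $s_{22}(z^*)\neq0$, $s_{22}(-q_0^2/z)\neq0$ and $$\rho(z)=-\tilde\rho^*(z^*)=\frac{q_-^*}{q_-}\,\tilde\rho\Big(-\frac{q_0^2}{z}\Big).$$ -/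

import Mathlib

open Filter Topology ComplexConjugate Matrix

noncomputable section

namespace NZBC

/-- `2 × 2` complex matrices. -/
abbrev Mat2 := Matrix (Fin 2) (Fin 2) ℂ

/-- The Pauli matrix `σ₃ = diag(1, -1)`. -/
def sigma3 : Mat2 := !![1, 0; 0, -1]

/-- The matrix `σ₀` (with `σ₀² = -I`) of the first symmetry. -/
def sigma0 : Mat2 := !![0, 1; -1, 0]

/-- The off-diagonal matrix with entries `a` and `-a^*`; it gives both the potential matrix
`Q(x,t)` (for `a = q(x,t)`) and its limits `Q_±` (for `a = q_±`). -/
def Qmat (a : ℂ) : Mat2 := !![0, a; -conj a, 0]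

/-- Entrywise complex conjugation `M ↦ M^*` (no transposition). -/
def cconj (M : Mat2) : Mat2 := M.map conj

/-- `e^{w σ₃} = diag(e^w, e^{-w})`. -/
def expSigma3 (w : ℂ) : Mat2 := !![Complex.exp w, 0; 0, Complex.exp (-w)]

/-- The spectral parameter `k(z) = (z - q₀²/z)/2` in the uniformizing variable. -/
def kz (q0 : ℝ) (z : ℂ) : ℂ := (z - (q0 : ℂ) ^ 2 / z) / 2

/-- `λ(z) = (z + q₀²/z)/2`, so that `λ² = k² + q₀²` and `z = k + λ`. -/
def lamz (q0 : ℝ) (z : ℂ) : ℂ := (z + (q0 : ℂ) ^ 2 / z) / 2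

/-- The phase `θ(x,t;z) = λ(z) (x + k(z) t)`. -/
def theta (q0 : ℝ) (x t : ℝ) (z : ℂ) : ℂ := lamz q0 z * ((x : ℂ) + kz q0 z * (t : ℂ))

/-- The continuous spectrum in the `z`-plane: the real axis without `0` together with the circle
`|z| = q₀`, the branch points `± i q₀` being removed. -/
def Sig (q0 : ℝ) : Set ℂ :=
  {z | z ≠ 0 ∧ (z.im = 0 ∨ ‖z‖ = q0) ∧ z ≠ Complex.I * q0 ∧ z ≠ -(Complex.I * q0)}

/-- The matrix `X = -i k σ₃ + Q` of the space part of the Lax pair. -/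
def laxX (q0 : ℝ) (q : ℝ → ℝ → ℂ) (x t : ℝ) (z : ℂ) : Mat2 :=
  -(Complex.I * kz q0 z) • sigma3 + Qmat (q x t)

/-- The matrix `T = -i k² σ₃ + k Q - (i/2) Q_x σ₃ - (i/2) (Q² + q₀² I) σ₃` of the time part of
the Lax pair. -/
def laxT (q0 : ℝ) (q : ℝ → ℝ → ℂ) (x t : ℝ) (z : ℂ) : Mat2 :=
  -(Complex.I * kz q0 z ^ 2) • sigma3 + kz q0 z • Qmat (q x t)
    - (Complex.I / 2) • (Qmat (deriv (fun y : ℝ => q y t) x) * sigma3)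
    - (Complex.I / 2) • ((Qmat (q x t) ^ 2 + ((q0 : ℂ) ^ 2) • (1 : Mat2)) * sigma3)

/-- `Y_±(z) = I - (i/z) σ₃ Q_±`, the eigenvector matrix of the asymptotic Lax pair. -/
def Ymat (a : ℂ) (z : ℂ) : Mat2 := 1 - (Complex.I / z) • (sigma3 * Qmat a)

/-- The potential `q(x,t)` is differentiable in `x` and tends, for every `t`, to the constants
`q_±` of modulus `q₀ > 0` as `x → ± ∞`. -/
structure IsPotential (q0 : ℝ) (q : ℝ → ℝ → ℂ) (qp qm : ℂ) : Prop where
  pos : 0 < q0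
  norm_plus : ‖qp‖ = q0
  norm_minus : ‖qm‖ = q0
  differentiable : ∀ t : ℝ, Differentiable ℝ (fun x : ℝ => q x t)
  tendsto_plus : ∀ t : ℝ, Tendsto (fun x : ℝ => q x t) atTop (𝓝 qp)
  tendsto_minus : ∀ t : ℝ, Tendsto (fun x : ℝ => q x t) atBot (𝓝 qm)

/-- `ψ(x,t;z)` is the Jost function normalized at the end `l` of the line (`l = atTop` for `ψ_+`,
`l = atBot` for `ψ_-`), where the potential tends to `a`: for every `z` in the continuous
spectrum it solves both equations of the Lax pair, `ψ_x = X ψ` and `ψ_t = T ψ`, and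
`ψ e^{iθσ₃} → Y(z)` as `x → l`. -/
structure IsJost (q0 : ℝ) (q : ℝ → ℝ → ℂ) (a : ℂ) (l : Filter ℝ)
    (ψ : ℝ → ℝ → ℂ → Mat2) : Prop where
  space : ∀ z ∈ Sig q0, ∀ (x t : ℝ) (i j : Fin 2),
    HasDerivAt (fun y : ℝ => ψ y t z i j) ((laxX q0 q x t z * ψ x t z) i j) x
  time : ∀ z ∈ Sig q0, ∀ (x t : ℝ) (i j : Fin 2),
    HasDerivAt (fun s : ℝ => ψ x s z i j) ((laxT q0 q x t z * ψ x t z) i j) t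
  normalization : ∀ z ∈ Sig q0, ∀ t : ℝ,
    Tendsto (fun x : ℝ => ψ x t z * expSigma3 (Complex.I * theta q0 x t z)) l (𝓝 (Ymat a z))

/-- `S(z)` is the scattering matrix: `ψ_+(x,t;z) = ψ_-(x,t;z) S(z)` for all `x`, `t`. -/
def IsScattering (q0 : ℝ) (ψp ψm : ℝ → ℝ → ℂ → Mat2) (S : ℂ → Mat2) : Prop :=
  ∀ z ∈ Sig q0, ∀ x t : ℝ, ψp x t z = ψm x t z * S z

/-- The reflection coefficient `ρ = s₂₁ / s₁₁`. -/
def rho (S : ℂ → Mat2) (z : ℂ) : ℂ := S z 1 0 / S z 0 0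

/-- The reflection coefficient `ρ̃ = s₁₂ / s₂₂`. -/
def rhoTilde (S : ℂ → Mat2) (z : ℂ) : ℂ := S z 0 1 / S z 1 1

/-- The symmetries of a Jost function `ψ` at the point `z`, in matrix form and by columns;
`a` is the boundary value `q_±`. -/
structure JostSymmetries (q0 : ℝ) (a : ℂ) (ψ : ℝ → ℝ → ℂ → Mat2) (x t : ℝ) (z : ℂ) : Prop where
  first : ψ x t z = -(sigma0 * cconj (ψ x t (conj z)) * sigma0)
  second : ψ x t z = -(Complex.I / z) • (ψ x t (-(q0 : ℂ) ^ 2 / z) * (sigma3 * Qmat a))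
  first_col1 : (ψ x t z).col 0 = sigma0 *ᵥ (cconj (ψ x t (conj z))).col 1
  first_col2 : (ψ x t z).col 1 = -(sigma0 *ᵥ (cconj (ψ x t (conj z))).col 0)
  second_col1 : (ψ x t z).col 0 =
    -(Complex.I * conj a / z) • (ψ x t (-(q0 : ℂ) ^ 2 / z)).col 1
  second_col2 : (ψ x t z).col 1 =
    -(Complex.I * a / z) • (ψ x t (-(q0 : ℂ) ^ 2 / z)).col 0

/-- The symmetries of the scattering matrix at the point `z`, in matrix form and by entries. -/
structure ScatteringSymmetries (q0 : ℝ) (qp qm : ℂ) (S : ℂ → Mat2) (z : ℂ) : Prop where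
  first : cconj (S (conj z)) = -(sigma0 * S z * sigma0)
  second : S z = (sigma3 * Qmat qm)⁻¹ * S (-(q0 : ℂ) ^ 2 / z) * (sigma3 * Qmat qp)
  s22_conj : S z 1 1 = conj (S (conj z) 0 0)
  s12_conj : S z 0 1 = -conj (S (conj z) 1 0)
  s11_inv : S z 0 0 = (conj qp / conj qm) * S (-(q0 : ℂ) ^ 2 / z) 1 1
  s12_inv : S z 0 1 = (qp / conj qm) * S (-(q0 : ℂ) ^ 2 / z) 1 0

/-- The symmetries of the reflection coefficients at a point `z` with `s₁₁(z) ≠ 0`; the first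
two fields say that the quotients on the right-hand sides have non-zero denominators. -/
structure ReflectionSymmetries (q0 : ℝ) (qm : ℂ) (S : ℂ → Mat2) (z : ℂ) : Prop where
  s22_conj_ne : S (conj z) 1 1 ≠ 0
  s22_inv_ne : S (-(q0 : ℂ) ^ 2 / z) 1 1 ≠ 0
  rho_conj : rho S z = -conj (rhoTilde S (conj z))
  rho_inv : rho S z = (conj qm / qm) * rhoTilde S (-(q0 : ℂ) ^ 2 / z)

end NZBC

end

open NZBC

/-! Both Lax matrices are traceless, so `adjugate A * B` is constant for any two solutions. Near one
end, this constant conjugated by the exponentials tends to `Y.det • 1`. On the spectrum `λ` is real,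
so the exponentials have modulus independent of `x`; the off-diagonal entries must then vanish, and
the normalization alone determines the solution (`solution_unique`). No integrability of `q - q_±`
is needed.

Each Jost symmetry holds because its right-hand side solves the same `x`-equation with the same
normalization. The matrix `ψ_-⁻¹ ψ_+` is constant in `x` and `t` by the adjugate argument, and
inherits the symmetries once `ψ_-` is cancelled. The reflection coefficients are then algebra. -/

namespace NZBC

/-! ### Traceless linear systems: conserved quantities and uniqueness -/

/-- Two solutions of a traceless `2 × 2` linear system have constant Wronskian. -/
theorem wronskian_const {X : ℝ → Mat2} (hX : ∀ x, X x 0 0 + X x 1 1 = 0) {A B : ℝ → Mat2}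
    (hA : ∀ x i j, HasDerivAt (fun y => A y i j) ((X x * A x) i j) x)
    (hB : ∀ x i j, HasDerivAt (fun y => B y i j) ((X x * B x) i j) x)
    (i j : Fin 2) (x y : ℝ) :
    A x 0 i * B x 1 j - A x 1 i * B x 0 j = A y 0 i * B y 1 j - A y 1 i * B y 0 j := by
  have hd : ∀ s, HasDerivAt (fun s => A s 0 i * B s 1 j - A s 1 i * B s 0 j) 0 s := by
    intro s
    refine (((hA s 0 i).mul (hB s 1 j)).sub ((hA s 1 i).mul (hB s 0 j))).congr_deriv ?_
    simp only [Matrix.mul_apply, Fin.sum_univ_two]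
    linear_combination (A s 0 i * B s 1 j - A s 1 i * B s 0 j) * hX s
  exact is_const_of_deriv_eq_zero (fun s => (hd s).differentiableAt) (fun s => (hd s).deriv) x y

/-- Up to sign, the entries of the product are Wronskians of a column of `A` with a column of `B`.
-/
theorem adjugate_mul_const {X : ℝ → Mat2} (hX : ∀ x, X x 0 0 + X x 1 1 = 0) {A B : ℝ → Mat2}
    (hA : ∀ x i j, HasDerivAt (fun y => A y i j) ((X x * A x) i j) x)
    (hB : ∀ x i j, HasDerivAt (fun y => B y i j) ((X x * B x) i j) x) (x y : ℝ) :
    adjugate (A x) * B x = adjugate (A y) * B y := by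
  have h := fun i j => wronskian_const hX hA hB i j x y
  ext i j
  fin_cases i <;> simp only [adjugate_fin_two, Matrix.mul_apply, Fin.sum_univ_two] <;> simp
  · linear_combination h 1 j * (-1)
  · linear_combination h 0 j

theorem det_const {X : ℝ → Mat2} (hX : ∀ x, X x 0 0 + X x 1 1 = 0) {A : ℝ → Mat2}
    (hA : ∀ x i j, HasDerivAt (fun y => A y i j) ((X x * A x) i j) x) (x y : ℝ) :
    (A x).det = (A y).det := by
  have h := wronskian_const hX hA hA 0 1 x y
  rw [det_fin_two, det_fin_two]
  linear_combination h

theorem det_expSigma3 (w : ℂ) : (expSigma3 w).det = 1 := by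
  simp [expSigma3, det_fin_two, ← Complex.exp_add]

theorem det_eq_of_tendsto {X : ℝ → Mat2} (hX : ∀ x, X x 0 0 + X x 1 1 = 0) {A : ℝ → Mat2}
    (hA : ∀ x i j, HasDerivAt (fun y => A y i j) ((X x * A x) i j) x)
    {l : Filter ℝ} [l.NeBot] {w : ℝ → ℂ} {Y : Mat2}
    (hlim : Tendsto (fun x => A x * expSigma3 (w x)) l (𝓝 Y)) (x : ℝ) :
    (A x).det = Y.det := by
  have h1 : Tendsto (fun y => (A y * expSigma3 (w y)).det) l (𝓝 Y.det) :=
    (continuous_id.matrix_det.tendsto Y).comp hlim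
  have h2 : (fun y => (A y * expSigma3 (w y)).det) = fun _ => (A x).det := by
    funext y
    rw [det_mul, det_expSigma3, mul_one, det_const hX hA y x]
  rw [h2] at h1
  exact tendsto_nhds_unique tendsto_const_nhds h1

/-- `f` may oscillate without a limit, but the norm of the product is the constant `r * ‖c‖`. -/
theorem eq_zero_of_tendsto_mul {l : Filter ℝ} [l.NeBot] {f : ℝ → ℂ} {r : ℝ} (hr : r ≠ 0)
    (hf : ∀ x, ‖f x‖ = r) {c : ℂ} (h : Tendsto (fun x => f x * c) l (𝓝 0)) : c = 0 := by
  have h1 := h.norm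
  simp only [norm_mul, hf, norm_zero] at h1
  have h2 := tendsto_nhds_unique tendsto_const_nhds h1
  simpa [hr] using h2

/-- A solution of a traceless system is determined by its behaviour at one end of the line, as
long as the exponential factors have constant modulus. -/
theorem solution_unique {X : ℝ → Mat2} (hX : ∀ x, X x 0 0 + X x 1 1 = 0) {A B : ℝ → Mat2}
    (hA : ∀ x i j, HasDerivAt (fun y => A y i j) ((X x * A x) i j) x)
    (hB : ∀ x i j, HasDerivAt (fun y => B y i j) ((X x * B x) i j) x)
    {l : Filter ℝ} [l.NeBot] {w : ℝ → ℂ} {r : ℝ} (hw : ∀ x, (w x).re = r)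
    {Y : Mat2} (hY : Y.det ≠ 0)
    (hlA : Tendsto (fun x => A x * expSigma3 (w x)) l (𝓝 Y))
    (hlB : Tendsto (fun x => B x * expSigma3 (w x)) l (𝓝 Y)) (x : ℝ) : A x = B x := by
  set C := adjugate (A x) * B x with hC
  have hlim : Tendsto (fun y => adjugate (expSigma3 (w y)) * C * expSigma3 (w y)) l
      (𝓝 (Y.det • (1 : Mat2))) := by
    rw [← adjugate_mul]
    have h1 : Tendsto (fun y => adjugate (A y * expSigma3 (w y)) * (B y * expSigma3 (w y))) l
        (𝓝 (adjugate Y * Y)) :=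
      ((continuous_id.matrix_adjugate.tendsto Y).comp hlA).mul hlB
    refine h1.congr fun y => ?_
    rw [adjugate_mul_distrib, hC, adjugate_mul_const hX hA hB x y]
    simp only [Matrix.mul_assoc]
  have hent : ∀ i j, Tendsto (fun y => (adjugate (expSigma3 (w y)) * C * expSigma3 (w y)) i j) l
      (𝓝 ((Y.det • (1 : Mat2)) i j)) := fun i j =>
    ((continuous_id.matrix_elem i j).tendsto _).comp hlim
  have e : ∀ v : ℂ, Complex.exp (-v) * Complex.exp v = 1 := fun v => by
    rw [← Complex.exp_add]; simp
  have h00 : C 0 0 = Y.det := by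
    refine tendsto_nhds_unique (tendsto_const_nhds (f := l)) ?_
    have := hent 0 0
    simp only [expSigma3, adjugate_fin_two, Matrix.mul_apply, Fin.sum_univ_two] at this
    simp at this
    refine this.congr fun y => ?_
    linear_combination C 0 0 * e (w y)
  have h11 : C 1 1 = Y.det := by
    refine tendsto_nhds_unique (tendsto_const_nhds (f := l)) ?_
    have := hent 1 1
    simp only [expSigma3, adjugate_fin_two, Matrix.mul_apply, Fin.sum_univ_two] at this
    simp at this
    refine this.congr fun y => ?_
    linear_combination C 1 1 * e (w y)
  have h01 : C 0 1 = 0 := by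
    refine eq_zero_of_tendsto_mul (l := l)
      (f := fun y => Complex.exp (-w y) * Complex.exp (-w y))
      (r := Real.exp (-r) * Real.exp (-r)) (by positivity)
      (fun y => by simp [Complex.norm_exp, hw]) ?_
    have := hent 0 1
    simp only [expSigma3, adjugate_fin_two, Matrix.mul_apply, Fin.sum_univ_two] at this
    simp at this
    exact this.congr fun y => by ring
  have h10 : C 1 0 = 0 := by
    refine eq_zero_of_tendsto_mul (l := l)
      (f := fun y => Complex.exp (w y) * Complex.exp (w y))
      (r := Real.exp r * Real.exp r) (by positivity)
      (fun y => by simp [Complex.norm_exp, hw]) ?_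
    have := hent 1 0
    simp only [expSigma3, adjugate_fin_two, Matrix.mul_apply, Fin.sum_univ_two] at this
    simp at this
    exact this.congr fun y => by ring
  have hCY : C = Y.det • (1 : Mat2) := by
    ext i j
    fin_cases i <;> fin_cases j <;> simp [h00, h01, h10, h11]
  -- Multiply `C` by `A x` on the left: `A * adjugate A` is the scalar `Y.det`.
  have h2 : Y.det • B x = Y.det • A x := by
    have h3 : A x * C = A x * (Y.det • (1 : Mat2)) := by rw [hCY]
    rw [hC, ← Matrix.mul_assoc, mul_adjugate, det_eq_of_tendsto hX hA hlA x] at h3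
    simpa using h3
  exact (smul_right_injective Mat2 hY h2).symm

/-! ### The spectrum, its two involutions, and the asymptotic data -/

section Spectrum

variable {q0 : ℝ} {z : ℂ}

theorem sq_div_eq_conj (h : ‖z‖ = q0) (hz : z ≠ 0) : (q0 : ℂ) ^ 2 / z = conj z := by
  rw [div_eq_iff hz, mul_comm, Complex.mul_conj, Complex.normSq_eq_norm_sq, h]
  push_cast; rfl

theorem conj_mem_Sig (h : z ∈ Sig q0) : conj z ∈ Sig q0 := by
  obtain ⟨h0, h1, h2, h3⟩ := h
  refine ⟨by simpa using h0, by simpa using h1, fun h => h3 ?_, fun h => h2 ?_⟩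
  · have := congrArg conj h
    simpa using this
  · have := congrArg conj h
    simpa using this

/-- On the circle the map is `z ↦ -conj z`. It fixes each branch point, whereas conjugation swaps
them. -/
theorem inv_mem_Sig (hq0 : 0 < q0) (h : z ∈ Sig q0) : -(q0 : ℂ) ^ 2 / z ∈ Sig q0 := by
  obtain ⟨h0, h1, h2, h3⟩ := h
  have hq : (q0 : ℂ) ≠ 0 := by exact_mod_cast hq0.ne'
  refine ⟨div_ne_zero (neg_ne_zero.2 (pow_ne_zero 2 hq)) h0, ?_, fun h => h2 ?_, fun h => h3 ?_⟩
  · rcases h1 with h1 | h1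
    · left
      obtain ⟨a, rfl⟩ : ∃ a : ℝ, z = a := ⟨z.re, by apply Complex.ext <;> simp [h1]⟩
      rw [show -(q0 : ℂ) ^ 2 / (a : ℂ) = ((-q0 ^ 2 / a : ℝ) : ℂ) by push_cast; rfl,
        Complex.ofReal_im]
    · right
      rw [neg_div, sq_div_eq_conj h1 h0]
      simpa using h1
  · rw [div_eq_iff h0] at h
    have hI := Complex.I_sq
    refine mul_left_cancel₀ (mul_ne_zero Complex.I_ne_zero hq) ?_
    linear_combination (-1) * h - (q0 : ℂ) ^ 2 * hI
  · rw [div_eq_iff h0] at h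
    have hI := Complex.I_sq
    refine mul_left_cancel₀ (mul_ne_zero Complex.I_ne_zero hq) ?_
    linear_combination h + (q0 : ℂ) ^ 2 * hI

theorem lamz_im (h : z ∈ Sig q0) : (lamz q0 z).im = 0 := by
  obtain ⟨h0, h1 | h1, -⟩ := h
  · obtain ⟨a, rfl⟩ : ∃ a : ℝ, z = a := ⟨z.re, by apply Complex.ext <;> simp [h1]⟩
    rw [lamz, show ((a : ℂ) + (q0 : ℂ) ^ 2 / (a : ℂ)) / 2 = (((a + q0 ^ 2 / a) / 2 : ℝ) : ℂ) by
      push_cast; rfl, Complex.ofReal_im]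
  · rw [lamz, sq_div_eq_conj h1 h0, Complex.add_conj]
    simp

/-- On the circle `k` is imaginary, so the real part need not vanish for `t ≠ 0`; what matters is
that it does not depend on `x`. -/
theorem I_mul_theta_re (h : z ∈ Sig q0) (x t : ℝ) :
    (Complex.I * theta q0 x t z).re = -((lamz q0 z).re * ((kz q0 z).im * t)) := by
  simp [theta, lamz_im h]

theorem kz_conj : kz q0 (conj z) = conj (kz q0 z) := by
  simp [kz, map_ofNat (starRingEnd ℂ) 2]

theorem lamz_conj : lamz q0 (conj z) = conj (lamz q0 z) := by
  simp [lamz, map_ofNat (starRingEnd ℂ) 2]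

theorem theta_conj (x t : ℝ) : theta q0 x t (conj z) = conj (theta q0 x t z) := by
  simp [theta, lamz_conj, kz_conj]

theorem kz_inv (hq0 : q0 ≠ 0) (hz : z ≠ 0) : kz q0 (-(q0 : ℂ) ^ 2 / z) = kz q0 z := by
  have hq : (q0 : ℂ) ≠ 0 := by exact_mod_cast hq0
  simp only [kz]; field_simp; ring

theorem lamz_inv (hq0 : q0 ≠ 0) (hz : z ≠ 0) : lamz q0 (-(q0 : ℂ) ^ 2 / z) = -lamz q0 z := by
  have hq : (q0 : ℂ) ≠ 0 := by exact_mod_cast hq0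
  simp only [lamz]; field_simp; ring

theorem theta_inv (hq0 : q0 ≠ 0) (hz : z ≠ 0) (x t : ℝ) :
    theta q0 x t (-(q0 : ℂ) ^ 2 / z) = -theta q0 x t z := by
  simp [theta, lamz_inv hq0 hz, kz_inv hq0 hz]

theorem conj_mul_eq_sq {a : ℂ} (ha : ‖a‖ = q0) : conj a * a = (q0 : ℂ) ^ 2 := by
  rw [mul_comm, Complex.mul_conj, Complex.normSq_eq_norm_sq, ha]
  push_cast; rfl

theorem sigma3_mul_Qmat (a : ℂ) : sigma3 * Qmat a = !![0, a; conj a, 0] := by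
  simp [sigma3, Qmat]

theorem sigma3_mul_Qmat_sq {a : ℂ} (ha : ‖a‖ = q0) :
    (sigma3 * Qmat a) * (sigma3 * Qmat a) = (q0 : ℂ) ^ 2 • (1 : Mat2) := by
  rw [sigma3_mul_Qmat, ← conj_mul_eq_sq ha]
  ext i j
  fin_cases i <;> fin_cases j <;> simp [Matrix.mul_apply, Fin.sum_univ_two, mul_comm]

/-- The determinant is `1 + q₀²/z²`, which vanishes exactly at the removed branch points. -/
theorem det_Ymat_ne_zero {a : ℂ} (ha : ‖a‖ = q0) (h : z ∈ Sig q0) : (Ymat a z).det ≠ 0 := by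
  obtain ⟨h0, -, h2, h3⟩ := h
  have hd : (Ymat a z).det = (z - Complex.I * q0) * (z + Complex.I * q0) / z ^ 2 := by
    rw [Ymat, sigma3_mul_Qmat, det_fin_two]
    simp
    field_simp
    linear_combination (-Complex.I ^ 2) * conj_mul_eq_sq ha
  rw [hd]
  refine div_ne_zero (mul_ne_zero (sub_ne_zero.2 h2) fun h => h3 ?_) (pow_ne_zero 2 h0)
  exact eq_neg_of_add_eq_zero_left h

theorem laxX_trace (q : ℝ → ℝ → ℂ) (x t : ℝ) :
    laxX q0 q x t z 0 0 + laxX q0 q x t z 1 1 = 0 := by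
  simp [laxX, sigma3, Qmat]

theorem laxT_trace (q : ℝ → ℝ → ℂ) (x t : ℝ) :
    laxT q0 q x t z 0 0 + laxT q0 q x t z 1 1 = 0 := by
  simp [laxT, sigma3, Qmat, pow_two, Matrix.mul_apply, Fin.sum_univ_two]
  ring

end Spectrum

/-! ### Symmetries of the Jost functions -/

section Jost

variable {q0 : ℝ} {q : ℝ → ℝ → ℂ} {a : ℂ} {l : Filter ℝ} {ψ : ℝ → ℝ → ℂ → Mat2} {z : ℂ}

theorem IsJost.det_ne_zero [l.NeBot] (h : IsJost q0 q a l ψ) (ha : ‖a‖ = q0) (hz : z ∈ Sig q0)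
    (x t : ℝ) : (ψ x t z).det ≠ 0 := by
  rw [det_eq_of_tendsto (fun x => laxX_trace q x t) (A := fun x => ψ x t z)
    (fun x i j => h.space z hz x t i j) (h.normalization z hz t) x]
  exact det_Ymat_ne_zero ha hz

theorem IsJost.eq_of_solution [l.NeBot] (h : IsJost q0 q a l ψ) (ha : ‖a‖ = q0)
    (hz : z ∈ Sig q0) (t : ℝ) {B : ℝ → Mat2}
    (hB : ∀ x i j, HasDerivAt (fun y => B y i j) ((laxX q0 q x t z * B x) i j) x)
    (hlB : Tendsto (fun x => B x * expSigma3 (Complex.I * theta q0 x t z)) l (𝓝 (Ymat a z)))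
    (x : ℝ) : ψ x t z = B x :=
  solution_unique (fun x => laxX_trace q x t) (A := fun x => ψ x t z)
    (fun x i j => h.space z hz x t i j) hB (fun x => I_mul_theta_re hz x t)
    (det_Ymat_ne_zero ha hz) (h.normalization z hz t) hlB x

theorem neg_sigma0_mul_cconj_mul_sigma0 (M : Mat2) :
    -(sigma0 * cconj M * sigma0) =
      !![conj (M 1 1), -conj (M 1 0); -conj (M 0 1), conj (M 0 0)] := by
  ext i j
  fin_cases i <;> fin_cases j <;>
    simp [sigma0, cconj, Matrix.vecMul, dotProduct, Matrix.mul_apply, Fin.sum_univ_two]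

theorem cconj_mul (M N : Mat2) : cconj (M * N) = cconj M * cconj N :=
  Matrix.map_mul

theorem sigma0_mul_sigma0 : sigma0 * sigma0 = -1 := by
  ext i j
  fin_cases i <;> fin_cases j <;> simp [sigma0, Matrix.mul_apply, Fin.sum_univ_two]

/-- Since `σ₀⁻¹ = -σ₀`, the map is conjugation by `σ₀` after entrywise conjugation, hence
multiplicative. -/
theorem neg_sigma0_cconj_mul (M N : Mat2) :
    -(sigma0 * cconj (M * N) * sigma0) =
      -(sigma0 * cconj M * sigma0) * -(sigma0 * cconj N * sigma0) := by
  have : -(sigma0 * cconj M * sigma0) * -(sigma0 * cconj N * sigma0) =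
      sigma0 * cconj M * (sigma0 * sigma0) * cconj N * sigma0 := by
    simp only [neg_mul_neg, Matrix.mul_assoc]
  rw [this, sigma0_mul_sigma0, cconj_mul]
  simp [Matrix.mul_assoc]

theorem laxX_conj (x t : ℝ) :
    -(sigma0 * cconj (laxX q0 q x t (conj z)) * sigma0) = laxX q0 q x t z := by
  rw [neg_sigma0_mul_cconj_mul_sigma0]
  ext i j
  fin_cases i <;> fin_cases j <;> simp [laxX, sigma3, Qmat, kz_conj]

theorem Ymat_conj : -(sigma0 * cconj (Ymat a (conj z)) * sigma0) = Ymat a z := by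
  rw [neg_sigma0_mul_cconj_mul_sigma0]
  ext i j
  fin_cases i <;> fin_cases j <;> simp [Ymat, sigma3_mul_Qmat, neg_div]

theorem expSigma3_conj (x t : ℝ) :
    -(sigma0 * cconj (expSigma3 (Complex.I * theta q0 x t (conj z))) * sigma0) =
      expSigma3 (Complex.I * theta q0 x t z) := by
  rw [neg_sigma0_mul_cconj_mul_sigma0]
  ext i j
  fin_cases i <;> fin_cases j <;> simp [expSigma3, theta_conj, ← Complex.exp_conj]

theorem continuous_neg_sigma0_cconj :
    Continuous fun M : Mat2 => -(sigma0 * cconj M * sigma0) := by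
  have : Continuous fun M : Mat2 => cconj M := continuous_id.matrix_map Complex.continuous_conj
  exact ((continuous_const.matrix_mul this).matrix_mul continuous_const).neg

theorem IsJost.symm_first [l.NeBot] (h : IsJost q0 q a l ψ) (ha : ‖a‖ = q0) (hz : z ∈ Sig q0)
    (x t : ℝ) : ψ x t z = -(sigma0 * cconj (ψ x t (conj z)) * sigma0) := by
  refine h.eq_of_solution ha hz t (B := fun x => -(sigma0 * cconj (ψ x t (conj z)) * sigma0))
    ?_ ?_ x
  · intro x i j
    rw [← laxX_conj, ← neg_sigma0_cconj_mul]
    simp only [neg_sigma0_mul_cconj_mul_sigma0]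
    have hs := fun i j => (h.space _ (conj_mem_Sig hz) x t i j).star
    fin_cases i <;> fin_cases j
    · exact hs 1 1
    · exact (hs 1 0).neg
    · exact (hs 0 1).neg
    · exact hs 0 0
  · have h1 := (continuous_neg_sigma0_cconj.tendsto _).comp
      (h.normalization _ (conj_mem_Sig hz) t)
    rw [Ymat_conj] at h1
    refine h1.congr fun y => ?_
    simp only [Function.comp_apply]
    rw [neg_sigma0_cconj_mul, expSigma3_conj]

/-- An off-diagonal factor swaps the two exponentials, which compensates the sign change of `θ`
under `z ↦ -q₀²/z`. -/
theorem expSigma3_neg_mul (w : ℂ) :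
    sigma3 * Qmat a * expSigma3 w = expSigma3 (-w) * (sigma3 * Qmat a) := by
  rw [sigma3_mul_Qmat]
  ext i j
  fin_cases i <;> fin_cases j <;>
    simp [expSigma3, Matrix.mul_apply, Fin.sum_univ_two, mul_comm]

/-- As `(σ₃Q)² = q₀² I`, the right factor interchanges the two terms of `Y`. -/
theorem Ymat_inv (ha : ‖a‖ = q0) (hq0 : q0 ≠ 0) (hz : z ≠ 0) :
    -(Complex.I / z) • (Ymat a (-(q0 : ℂ) ^ 2 / z) * (sigma3 * Qmat a)) = Ymat a z := by
  have hq : (q0 : ℂ) ≠ 0 := by exact_mod_cast hq0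
  rw [Ymat, Ymat, Matrix.sub_mul, Matrix.smul_mul, sigma3_mul_Qmat_sq ha, Matrix.one_mul,
    smul_sub, smul_smul, smul_smul]
  have h1 : -(Complex.I / z) * (Complex.I / (-(q0 : ℂ) ^ 2 / z)) * (q0 : ℂ) ^ 2 = -1 := by
    field_simp
    simp
  rw [h1]
  module

theorem IsJost.symm_second [l.NeBot] (h : IsJost q0 q a l ψ) (ha : ‖a‖ = q0) (hq0 : 0 < q0)
    (hz : z ∈ Sig q0) (x t : ℝ) :
    ψ x t z = -(Complex.I / z) • (ψ x t (-(q0 : ℂ) ^ 2 / z) * (sigma3 * Qmat a)) := by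
  have hz0 : z ≠ 0 := hz.1
  have hz' := inv_mem_Sig hq0 hz
  refine h.eq_of_solution ha hz t
    (B := fun x => -(Complex.I / z) • (ψ x t (-(q0 : ℂ) ^ 2 / z) * (sigma3 * Qmat a))) ?_ ?_ x
  · intro x i j
    -- `X` depends on `z` only through `k`, and right multiplication by a constant matrix preserves
    -- solutions.
    have hX : laxX q0 q x t z = laxX q0 q x t (-(q0 : ℂ) ^ 2 / z) := by
      simp only [laxX, kz_inv hq0.ne' hz0]
    rw [hX, Matrix.mul_smul, ← Matrix.mul_assoc (laxX q0 q x t _)]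
    simp only [Matrix.smul_apply, smul_eq_mul,
      Matrix.mul_apply (N := sigma3 * Qmat a), Fin.sum_univ_two]
    exact (((h.space _ hz' x t i 0).mul_const _).add
      ((h.space _ hz' x t i 1).mul_const _)).const_mul _
  · have h1 := ((h.normalization _ hz' t).mul_const (sigma3 * Qmat a)).const_smul
      (-(Complex.I / z))
    rw [Ymat_inv ha hq0.ne' hz0] at h1
    refine h1.congr fun y => ?_
    rw [Matrix.smul_mul, Matrix.mul_assoc (ψ _ _ _), Matrix.mul_assoc (ψ _ _ _),
      expSigma3_neg_mul, theta_inv hq0.ne' hz0, mul_neg]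

theorem IsJost.symmetries [l.NeBot] (h : IsJost q0 q a l ψ) (ha : ‖a‖ = q0) (hq0 : 0 < q0)
    (hz : z ∈ Sig q0) (x t : ℝ) : JostSymmetries q0 a ψ x t z := by
  have h1 := h.symm_first ha hz x t
  have h2 := h.symm_second ha hq0 hz x t
  have e1 := fun i j => congrFun (congrFun h1 i) j
  have e2 := fun i j => congrFun (congrFun h2 i) j
  rw [neg_sigma0_mul_cconj_mul_sigma0] at e1
  rw [sigma3_mul_Qmat] at e2
  refine ⟨h1, h2, ?_, ?_, ?_, ?_⟩ <;> ext i
  · rw [Matrix.col_apply, e1]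
    fin_cases i <;> simp [sigma0, cconj, dotProduct, Fin.sum_univ_two]
  · rw [Matrix.col_apply, e1]
    fin_cases i <;> simp [sigma0, cconj, dotProduct, Fin.sum_univ_two]
  · rw [Matrix.col_apply, e2]
    simp [Matrix.mul_apply, Fin.sum_univ_two]
    ring
  · rw [Matrix.col_apply, e2]
    simp [Matrix.mul_apply, Fin.sum_univ_two]
    ring

end Jost

/-! ### The scattering matrix and the reflection coefficients -/

section Scattering

variable {q0 : ℝ} {q : ℝ → ℝ → ℂ} {qp qm : ℂ} {ψp ψm : ℝ → ℝ → ℂ → Mat2} {z : ℂ}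

theorem mul_left_cancel_of_det_ne_zero {A M N : Mat2} (hA : A.det ≠ 0) (h : A * M = A * N) :
    M = N :=
  ((Matrix.isUnit_iff_isUnit_det A).2 (isUnit_iff_ne_zero.2 hA)).mul_left_cancel h

theorem exists_unique_scattering {lp lm : Filter ℝ} [lm.NeBot] (hp : IsJost q0 q qp lp ψp)
    (hm : IsJost q0 q qm lm ψm) (hqm : ‖qm‖ = q0) (hz : z ∈ Sig q0) :
    ∃! M : Mat2, ∀ x t : ℝ, ψp x t z = ψm x t z * M := by
  have hdet := hm.det_ne_zero hqm hz
  have hconst : ∀ x t, adjugate (ψm x t z) * ψp x t z = adjugate (ψm 0 0 z) * ψp 0 0 z := by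
    intro x t
    -- Move to `x = 0` by the space equation, then along `x = 0` to `t = 0` by the time equation.
    rw [adjugate_mul_const (fun x => laxX_trace q x t) (A := fun x => ψm x t z)
      (B := fun x => ψp x t z) (fun x i j => hm.space z hz x t i j)
      (fun x i j => hp.space z hz x t i j) x 0]
    exact adjugate_mul_const (fun t => laxT_trace q 0 t) (A := fun t => ψm 0 t z)
      (B := fun t => ψp 0 t z) (fun t i j => hm.time z hz 0 t i j)
      (fun t i j => hp.time z hz 0 t i j) t 0
  have hdc : ∀ x t, (ψm x t z).det = (ψm 0 0 z).det := by
    intro x t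
    rw [det_const (fun x => laxX_trace q x t) (A := fun x => ψm x t z)
      (fun x i j => hm.space z hz x t i j) x 0]
    exact det_const (fun t => laxT_trace q 0 t) (A := fun t => ψm 0 t z)
      (fun t i j => hm.time z hz 0 t i j) t 0
  refine ⟨(ψm 0 0 z).det⁻¹ • (adjugate (ψm 0 0 z) * ψp 0 0 z), fun x t => ?_, fun M hM => ?_⟩
  · rw [← hconst x t, ← hdc x t, Matrix.mul_smul, ← Matrix.mul_assoc, mul_adjugate,
      Matrix.smul_mul, Matrix.one_mul, smul_smul, inv_mul_cancel₀ (hdet x t), one_smul]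
  · rw [hM 0 0, ← Matrix.mul_assoc, adjugate_mul, Matrix.smul_mul, Matrix.one_mul, smul_smul,
      inv_mul_cancel₀ (hdet 0 0), one_smul]

theorem scattering_symm_first {S : ℂ → Mat2} (hS : IsScattering q0 ψp ψm S) (hz : z ∈ Sig q0)
    (hp : JostSymmetries q0 qp ψp 0 0 z) (hm : JostSymmetries q0 qm ψm 0 0 z)
    (hdet : (ψm 0 0 z).det ≠ 0) : S z = -(sigma0 * cconj (S (conj z)) * sigma0) := by
  refine mul_left_cancel_of_det_ne_zero hdet ?_
  rw [← hS z hz 0 0, hp.first, hS _ (conj_mem_Sig hz) 0 0, neg_sigma0_cconj_mul, ← hm.first]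

theorem scattering_symm_second {S : ℂ → Mat2} (hS : IsScattering q0 ψp ψm S) (hq0 : 0 < q0)
    (hz : z ∈ Sig q0) (hp : JostSymmetries q0 qp ψp 0 0 z) (hm : JostSymmetries q0 qm ψm 0 0 z)
    (hdet : (ψm 0 0 (-(q0 : ℂ) ^ 2 / z)).det ≠ 0) :
    sigma3 * Qmat qm * S z = S (-(q0 : ℂ) ^ 2 / z) * (sigma3 * Qmat qp) := by
  refine mul_left_cancel_of_det_ne_zero hdet ?_
  have h1 : -(Complex.I / z) ≠ 0 := neg_ne_zero.2 (div_ne_zero Complex.I_ne_zero hz.1)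
  -- Restoring the factor `-i/z` makes the second Jost symmetry applicable on both sides.
  refine smul_right_injective Mat2 h1 ?_
  simp only
  rw [← Matrix.mul_assoc, ← Matrix.mul_assoc (ψm 0 0 _) (S _), ← hS _ (inv_mem_Sig hq0 hz) 0 0,
    ← hp.second, hS z hz 0 0, ← Matrix.smul_mul, ← hm.second]

theorem scattering_symmetries {S : ℂ → Mat2} (hS : IsScattering q0 ψp ψm S) (hq0 : 0 < q0)
    (hqm : ‖qm‖ = q0)
    (hz : z ∈ Sig q0) (hp : JostSymmetries q0 qp ψp 0 0 z) (hm : JostSymmetries q0 qm ψm 0 0 z)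
    (hdet : (ψm 0 0 z).det ≠ 0) (hdet' : (ψm 0 0 (-(q0 : ℂ) ^ 2 / z)).det ≠ 0) :
    ScatteringSymmetries q0 qp qm S z := by
  have h1 := scattering_symm_first hS hz hp hm hdet
  have h2 := scattering_symm_second hS hq0 hz hp hm hdet'
  have hqm0 : qm ≠ 0 := by
    rw [← norm_ne_zero_iff, hqm]; exact hq0.ne'
  have hcqm0 : conj qm ≠ 0 := by simpa using hqm0
  have hu : IsUnit (sigma3 * Qmat qm).det := by
    rw [sigma3_mul_Qmat, det_fin_two, isUnit_iff_ne_zero]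
    simp [hqm0]
  have e1 := fun i j => congrFun (congrFun h1 i) j
  rw [neg_sigma0_mul_cconj_mul_sigma0] at e1
  have e2 := fun i j => congrFun (congrFun h2 i) j
  simp only [sigma3_mul_Qmat] at e2
  refine ⟨?_, ?_, ?_, ?_, ?_, ?_⟩
  · rw [h1]
    have h3 : -(sigma0 * -(sigma0 * cconj (S (conj z)) * sigma0) * sigma0) =
        (sigma0 * sigma0) * cconj (S (conj z)) * (sigma0 * sigma0) := by
      simp only [Matrix.mul_neg, Matrix.neg_mul, neg_neg, Matrix.mul_assoc]
    rw [h3, sigma0_mul_sigma0]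
    simp
  · rw [Matrix.mul_assoc, ← h2, Matrix.nonsing_inv_mul_cancel_left _ _ hu]
  · simpa using e1 1 1
  · simpa using e1 0 1
  · have := e2 1 0
    simp [Matrix.mul_apply, Fin.sum_univ_two] at this
    rw [div_mul_eq_mul_div, eq_div_iff hcqm0]
    linear_combination this
  · have := e2 1 1
    simp [Matrix.mul_apply, Fin.sum_univ_two] at this
    rw [div_mul_eq_mul_div, eq_div_iff hcqm0]
    linear_combination this

theorem reflection_symmetries {S : ℂ → Mat2} (hqm : qm ≠ 0)
    (h : ScatteringSymmetries q0 qp qm S z)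
    (hne : S z 0 0 ≠ 0) : ReflectionSymmetries q0 qm S z := by
  have hcqm : conj qm ≠ 0 := by simpa using hqm
  have hcqp : conj qp ≠ 0 := fun h0 => hne (by rw [h.s11_inv, h0, zero_div, zero_mul])
  have e1 := fun i j => congrFun (congrFun h.first i) j
  have h11 : conj (S (conj z) 1 1) = S z 0 0 := by
    simpa [sigma0, cconj, Matrix.vecMul, dotProduct, Matrix.mul_apply, Fin.sum_univ_two] using e1 1 1
  have h01 : conj (S (conj z) 0 1) = -S z 1 0 := by
    simpa [sigma0, cconj, Matrix.vecMul, dotProduct, Matrix.mul_apply, Fin.sum_univ_two] using e1 0 1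
  have hu : IsUnit (sigma3 * Qmat qm).det := by
    rw [sigma3_mul_Qmat, det_fin_two, isUnit_iff_ne_zero]
    simp [hqm]
  have h2 : sigma3 * Qmat qm * S z = S (-(q0 : ℂ) ^ 2 / z) * (sigma3 * Qmat qp) := by
    rw [h.second, Matrix.mul_assoc _⁻¹, Matrix.mul_nonsing_inv_cancel_left _ _ hu]
  -- The relation for `s₂₁` is not among the listed entries; it is read off the matrix symmetry with
  -- the inverse cleared.
  have h10 : qm * S z 1 0 = S (-(q0 : ℂ) ^ 2 / z) 0 1 * conj qp := by
    have := congrFun (congrFun h2 0) 0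
    simp only [sigma3_mul_Qmat] at this
    simpa [Matrix.mul_apply, Fin.sum_univ_two] using this
  have hinv : S (-(q0 : ℂ) ^ 2 / z) 1 1 ≠ 0 := fun h0 => hne (by rw [h.s11_inv, h0, mul_zero])
  refine ⟨fun h0 => hne (by rw [← h11, h0, map_zero]), hinv, ?_, ?_⟩
  · rw [rho, rhoTilde, map_div₀, h11, h01]
    ring
  · rw [rho, rhoTilde, h.s11_inv]
    generalize S (-(q0 : ℂ) ^ 2 / z) = M at *
    field_simp
    linear_combination h10

end Scattering

end NZBC

theorem mainTheorem3
    (q0 : ℝ) (q : ℝ → ℝ → ℂ) (qp qm : ℂ) (hq : IsPotential q0 q qp qm)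
    (ψp ψm : ℝ → ℝ → ℂ → Mat2)
    (hp : IsJost q0 q qp atTop ψp) (hm : IsJost q0 q qm atBot ψm) :
    (∀ z ∈ Sig q0, ∀ x t : ℝ,
      JostSymmetries q0 qp ψp x t z ∧ JostSymmetries q0 qm ψm x t z) ∧
    (∀ z ∈ Sig q0, ∃! M : Mat2, ∀ x t : ℝ, ψp x t z = ψm x t z * M) ∧
    (∀ S : ℂ → Mat2, IsScattering q0 ψp ψm S →
      ∀ z ∈ Sig q0, ScatteringSymmetries q0 qp qm S z ∧
        (S z 0 0 ≠ 0 → ReflectionSymmetries q0 qm S z)) := by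
  have hqm0 : qm ≠ 0 := by rw [← norm_ne_zero_iff, hq.norm_minus]; exact hq.pos.ne'
  have hJ : ∀ z ∈ Sig q0, ∀ x t : ℝ,
      JostSymmetries q0 qp ψp x t z ∧ JostSymmetries q0 qm ψm x t z := fun z hz x t =>
    ⟨hp.symmetries hq.norm_plus hq.pos hz x t, hm.symmetries hq.norm_minus hq.pos hz x t⟩
  refine ⟨hJ, fun z hz => exists_unique_scattering hp hm hq.norm_minus hz, fun S hS z hz => ?_⟩
  have hsc : ScatteringSymmetries q0 qp qm S z :=
    scattering_symmetries hS hq.pos hq.norm_minus hz (hJ z hz 0 0).1 (hJ z hz 0 0).2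
      (hm.det_ne_zero hq.norm_minus hz 0 0)
      (hm.det_ne_zero hq.norm_minus (inv_mem_Sig hq.pos hz) 0 0)
  exact ⟨hsc, reflection_symmetries hqm0 hsc⟩
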